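/- Let $\mathbb{K}=\mathbb{R}$ or $\mathbb{C}$, let $n\ge 1$, $r>0$, let $C=C([-r,0],\mathbb{K}^n)$ carry the supremum norm, and let $L\colon C\to\mathbb{K}^n$ be a continuous linear map. Let $\eta\colon(-\infty,0]\to M_n(\mathbb{K})$ be of bounded variation on $[-r,0]$, constant on $(-\infty,-r]$, and such that $L\psi=\int_{-r}^0 \mathrm{d}\eta(\theta)\,\psi(\theta)$ (Riemann–Stieltjes integral) for all $\psi\in C$. Let $\phi\colon[-r,0]\to\mathbb{K}^n$ be a Lebesgue integrable function, defined almost everywhere and defined at $0$. A mild solution of $\dot x(t)=Lx_t$ $(t\ge 0)$ under $x_0=\phi$ is a locally Lebesgue integrable function $x$ with values in $\mathbb{K}^n$, defined almost everywhere on $[-r,\infty)$ and everywhere on $[0,\infty)$, with $$x(t)=\phi(0)+L\int_0^t x_s\,\mathrm{d}s\quad(t\ge 0),\qquad x(t)=\phi(t)\quad(\text{a.e. } t\in[-r,0]),$$ where $\int_0^t x_s\,\mathrm{d}s\in C$ is the function $\theta\mapsto\int_0^t x(s+\theta)\,\mathrm{d}s$. Let $\bar\phi(t)=\phi(t)$ for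 $t<0$ and $\bar\phi(t)=\phi(0)$ for $t\ge 0$, and for $t\ge 0$ put $$G(t;\phi)=\int_{-r}^0\mathrm{d}\eta(\theta)\left(\int_\theta^0\phi(s)\,\mathrm{d}s\right)+\int_{-r}^{-t}\mathrm{d}\eta(\theta)\left(\int_0^{t+\theta}\bar\phi(s)\,\mathrm{d}s\right).$$ Theorem. The Riemann–Stieltjes integrals defining $G(t;\phi)$ exist for every $t\ge 0$, and there is a locally integrable function $f(\cdot;\phi)\colon[0,\infty)\to\mathbb{K}^n$, vanishing on $[r,\infty)$, such that $G(\cdot;\phi)$ is differentiable with $\dot G(t;\phi)=f(t;\phi)$ for almost every $t\ge 0$. If $x=x(\cdot;\phi)$ is the mild solution under $x_0=\phi$, then $x|_{[0,\infty)}$ is differentiable almost everywhere, the Riemann–Stieltjes integral $\int_{-t}^0\mathrm{d}\eta(\theta)\,x(t+\theta;\phi)$ exists for every $t\ge 0$, and $$\dot x(t;\phi)=\int_{-t}^0\mathrm{d}\eta(\theta)\,x(t+\theta;\phi)+f(t;\phi)\qquad\text{for almost every } t\ge 0.$$ -/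

import Mathlib

open MeasureTheory Set
open scoped Matrix

-- Matrices carry the operator norm induced by the maximum norm on `Fin n → 𝕜`.
attribute [local instance] Matrix.linftyOpNormedAddCommGroup

noncomputable section

namespace RFDE

variable {𝕜 : Type*} [RCLike 𝕜] {n : ℕ}

/-- `I` is the Riemann–Stieltjes integral `∫_a^b dα(u) f(u)` of the vector-valued function `f` with
respect to the matrix-valued function `α`: the sums `∑ [α (p (k+1)) - α (p k)] f (τ k)` over tagged
partitions `a = p 0, …, p m = b` converge to `I` as the mesh tends to `0`. The partition is
increasing if `a ≤ b` and decreasing if `b ≤ a`, so that `∫_b^a = - ∫_a^b`. -/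
def HasRSIntegral (α : ℝ → Matrix (Fin n) (Fin n) 𝕜) (f : ℝ → Fin n → 𝕜) (a b : ℝ)
    (I : Fin n → 𝕜) : Prop :=
  ∀ ε > 0, ∃ δ > 0, ∀ (m : ℕ) (p τ : ℕ → ℝ),
    p 0 = a → p m = b →
    ((∀ k < m, p k ≤ p (k + 1)) ∨ (∀ k < m, p (k + 1) ≤ p k)) →
    (∀ k < m, |p (k + 1) - p k| < δ) →
    (∀ k < m, τ k ∈ uIcc (p k) (p (k + 1))) →
    ‖∑ k ∈ Finset.range m, (α (p (k + 1)) - α (p k)) *ᵥ f (τ k) - I‖ < ε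

/-- The Riemann–Stieltjes integral `∫_a^b dα(u) f(u)` exists. -/
def RSIntegrable (α : ℝ → Matrix (Fin n) (Fin n) 𝕜) (f : ℝ → Fin n → 𝕜) (a b : ℝ) : Prop :=
  ∃ I, HasRSIntegral α f a b I

open Classical in
/-- The value of the Riemann–Stieltjes integral `∫_a^b dα(u) f(u)` (and `0` if it does not
exist). -/
def rsIntegral (α : ℝ → Matrix (Fin n) (Fin n) 𝕜) (f : ℝ → Fin n → 𝕜) (a b : ℝ) : Fin n → 𝕜 :=
  if h : RSIntegrable α f a b then h.choose else 0

theorem continuous_historyIntegral {r : ℝ} {x : ℝ → Fin n → 𝕜}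
    (hx : LocallyIntegrableOn x (Ici (-r))) {t : ℝ} (ht : 0 ≤ t) :
    Continuous (fun θ : Icc (-r) (0 : ℝ) => ∫ s in (0 : ℝ)..t, x (s + θ)) := by
  rcases lt_or_ge r 0 with hr | hr
  · have : IsEmpty (Icc (-r) (0 : ℝ)) := ⟨fun θ => by linarith [θ.2.1, θ.2.2]⟩
    exact continuous_of_const fun θ => (this.false θ).elim
  have hI : IntegrableOn x (uIcc (-r) t) volume := by
    rw [uIcc_of_le (by linarith)]
    exact hx.integrableOn_compact_subset Icc_subset_Ici_self isCompact_Icc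
  have hc := intervalIntegral.continuousOn_primitive_interval hI
  rw [uIcc_of_le (by linarith : -r ≤ t)] at hc
  have hi : ∀ a ∈ Icc (-r) t, IntervalIntegrable x volume (-r) a := fun a ha =>
    (hI.mono_set (by
      rw [uIcc_of_le ha.1, uIcc_of_le (by linarith : -r ≤ t)]
      exact Icc_subset_Icc_right ha.2)).intervalIntegrable
  have hm1 : ∀ θ : Icc (-r) (0 : ℝ), (θ : ℝ) ∈ Icc (-r) t := fun θ =>
    ⟨θ.2.1, θ.2.2.trans ht⟩
  have hm2 : ∀ θ : Icc (-r) (0 : ℝ), t + (θ : ℝ) ∈ Icc (-r) t := fun θ =>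
    ⟨by linarith [θ.2.1], by linarith [θ.2.2]⟩
  have h1 : Continuous fun θ : Icc (-r) (0 : ℝ) => ∫ s in (-r)..(θ : ℝ), x s :=
    hc.comp_continuous continuous_subtype_val hm1
  have h2 : Continuous fun θ : Icc (-r) (0 : ℝ) => ∫ s in (-r)..(t + (θ : ℝ)), x s :=
    hc.comp_continuous (continuous_const.add continuous_subtype_val) hm2
  refine (h2.sub h1).congr fun θ => ?_
  rw [intervalIntegral.integral_comp_add_right (fun s => x s) (θ : ℝ), zero_add]
  exact intervalIntegral.integral_interval_sub_left (hi _ (hm2 θ)) (hi _ (hm1 θ))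

/-- The element `∫_0^t x_s ds` of `C([-r, 0], 𝕜ⁿ)`, given by `θ ↦ ∫_0^t x (s + θ) ds`. -/
def historyIntegral {r : ℝ} {x : ℝ → Fin n → 𝕜} (hx : LocallyIntegrableOn x (Ici (-r)))
    {t : ℝ} (ht : 0 ≤ t) : C(Icc (-r) (0 : ℝ), Fin n → 𝕜) where
  toFun θ := ∫ s in (0 : ℝ)..t, x (s + θ)
  continuous_toFun := continuous_historyIntegral hx ht

/-- `x` is a mild solution of `ẋ(t) = L x_t` (`t ≥ 0`) under the initial condition `x_0 = φ`.
Functions defined almost everywhere on `[-r, 0]`, or on `[-r, ∞)`, are represented by functions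
on `ℝ` whose values off the domain play no role. -/
structure IsMildSolution {r : ℝ}
    (L : C(Icc (-r) (0 : ℝ), Fin n → 𝕜) →L[𝕜] (Fin n → 𝕜))
    (φ x : ℝ → Fin n → 𝕜) : Prop where
  locallyIntegrableOn : LocallyIntegrableOn x (Ici (-r))
  eq_of_nonneg : ∀ t (ht : 0 ≤ t), x t = φ 0 + L (historyIntegral locallyIntegrableOn ht)
  ae_eq_history : ∀ᵐ t ∂volume.restrict (Icc (-r) 0), x t = φ t

/-- The matrix-valued function `η : (-∞, 0] → M_n(𝕜)` is of bounded variation on `[-r, 0]`, is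
constant on `(-∞, -r]`, and `L ψ = ∫_{-r}^0 dη(θ) ψ(θ)` for all `ψ ∈ C([-r, 0], 𝕜ⁿ)`.
The values of `η` on `(0, ∞)` play no role. -/
structure Represents {r : ℝ} (hr : 0 < r) (η : ℝ → Matrix (Fin n) (Fin n) 𝕜)
    (L : C(Icc (-r) (0 : ℝ), Fin n → 𝕜) →L[𝕜] (Fin n → 𝕜)) : Prop where
  boundedVariationOn : BoundedVariationOn η (Icc (-r) 0)
  const : ∀ θ ≤ -r, η θ = η (-r)
  hasRSIntegral : ∀ ψ : C(Icc (-r) (0 : ℝ), Fin n → 𝕜),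
    HasRSIntegral η (IccExtend (neg_nonpos.mpr hr.le) ψ) (-r) 0 (L ψ)

/-- The static prolongation of `φ`: equal to `φ 0` on `[0, ∞)` and to `φ` before `0`. -/
def staticProlongation (φ : ℝ → Fin n → 𝕜) (t : ℝ) : Fin n → 𝕜 :=
  if 0 ≤ t then φ 0 else φ t

/-- The integrand `θ ↦ ∫_θ^0 φ(s) ds` of the first term of `G`. -/
def integrandG₁ (φ : ℝ → Fin n → 𝕜) (θ : ℝ) : Fin n → 𝕜 :=
  ∫ s in θ..0, φ s

/-- The integrand `θ ↦ ∫_0^{t+θ} φ̄(s) ds` of the second term of `G`, where `φ̄` is the static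
prolongation of `φ`. -/
def integrandG₂ (φ : ℝ → Fin n → 𝕜) (t θ : ℝ) : Fin n → 𝕜 :=
  ∫ s in (0 : ℝ)..(t + θ), staticProlongation φ s

/-- `G(t; φ) = ∫_{-r}^0 dη(θ) (∫_θ^0 φ(s) ds) + ∫_{-r}^{-t} dη(θ) (∫_0^{t+θ} φ̄(s) ds)`. -/
def G (r : ℝ) (η : ℝ → Matrix (Fin n) (Fin n) 𝕜) (φ : ℝ → Fin n → 𝕜) (t : ℝ) : Fin n → 𝕜 :=
  rsIntegral η (integrandG₁ φ) (-r) 0 + rsIntegral η (integrandG₂ φ t) (-r) (-t)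

end RFDE

end

/-!
The argument stays with the functional `L` on `C([-r, 0], 𝕜ⁿ)` wherever possible, so that neither
measures nor a general existence theorem for Riemann–Stieltjes integrals are needed. A primitive of
a mild solution `x` splits as `Φ + X - R` (`IsMildSolution.primitive_eq`): `Φ` is the primitive of
the history extended by zero, `X` is the `C¹` primitive of the continuous function
`u ↦ x (max u 0)`, and the ramp `R u = min(u, 0) x(0)` cancels `X` on `(-∞, 0]`.
Writing `g_t` for the segment `θ ↦ g (t + θ)`, the mild equation becomes
`x(t) = φ(0) + G(t) + L X_t - L R_t` with `G(t) = L Φ_t - L Φ_0`, and the terms are differentiated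
separately.

* `G` is of bounded variation (`boundedVariationOn_clm_comp`): rotating the increments of each
  coordinate of `L Φ_t` to nonnegative reals and using linearity, the variation is at most
  `n ‖L‖ ∫ ‖φ‖`. Hence `G` is differentiable almost everywhere, and its derivative is integrable,
  being dominated by the derivative of the variation function. Since `G` is constant on `[r, ∞)`,
  the derivative may be taken to vanish there.
* `t ↦ X_t` is a `C¹` curve in `C([-r, 0], 𝕜ⁿ)` (`hasDerivAt_segment_primitive`), so the derivative
  of `L X_t` is `L` of the segment at `t` of `u ↦ x (max u 0)`.
* Difference quotients of `R` are approximate step functions, and their Riemann–Stieltjes sums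
  telescope up to the variation of `η` near `-t`. Hence `L R_t` has derivative
  `(η(-t) - η(-r)) x(0)` except at the countably many `t` for which the variation function of `η`
  is discontinuous at `-t` (`Represents.ae_hasDerivAt_ramp`).

Finally `∫_{-t}^0 dη(θ) x(t + θ)` exists and equals the difference of the last two derivatives
(`Represents.hasRSIntegral_translate`). The integral of `x (max (t + θ) 0)` over `[-r, 0]` is a
value of `L`. For `t ≤ r` this integrand is constant on `[-r, -t]`, so that completing a partition
of `[-t, 0]` to the left adds exactly `(η(-t) - η(-r)) x(0)` to its sum; for `t > r` this term
vanishes, and `[-r, 0]` may be enlarged to `[-t, 0]` because `η` is constant on `(-∞, -r]`.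
The integrals in `G` are obtained likewise.
-/

noncomputable section

namespace RFDE

variable {𝕜 : Type*} [RCLike 𝕜] {n : ℕ}

/-! ### Tagged partitions -/

/-- `a = p 0 ≤ … ≤ p m = b` is an increasing partition with tags `τ k ∈ [p k, p (k + 1)]` and all
steps shorter than `δ`. The values of `p` beyond `m` and of `τ` from `m` on are irrelevant. -/
structure IsTaggedPartition (a b δ : ℝ) (m : ℕ) (p τ : ℕ → ℝ) : Prop where
  zero : p 0 = a
  last : p m = b
  le : ∀ k < m, p k ≤ p (k + 1)
  mesh : ∀ k < m, p (k + 1) - p k < δ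
  tag : ∀ k < m, τ k ∈ Icc (p k) (p (k + 1))

/-- The Riemann–Stieltjes sum of `f` with respect to `α` over a tagged partition. -/
def rsSum (α : ℝ → Matrix (Fin n) (Fin n) 𝕜) (f : ℝ → Fin n → 𝕜) (m : ℕ) (p τ : ℕ → ℝ) :
    Fin n → 𝕜 :=
  ∑ k ∈ Finset.range m, (α (p (k + 1)) - α (p k)) *ᵥ f (τ k)

namespace IsTaggedPartition

variable {a b c δ : ℝ} {m N : ℕ} {p τ q σ : ℕ → ℝ}

theorem mono (h : IsTaggedPartition a b δ m p τ) {j k : ℕ} (hjk : j ≤ k) (hk : k ≤ m) :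
    p j ≤ p k := by
  induction k, hjk using Nat.le_induction with
  | base => exact le_rfl
  | succ k _ ih => exact (ih (by omega)).trans (h.le k (by omega))

theorem mem_Icc (h : IsTaggedPartition a b δ m p τ) {k : ℕ} (hk : k ≤ m) : p k ∈ Icc a b :=
  ⟨h.zero ▸ h.mono (Nat.zero_le k) hk, h.last ▸ h.mono hk le_rfl⟩

theorem tag_mem_Icc (h : IsTaggedPartition a b δ m p τ) {k : ℕ} (hk : k < m) : τ k ∈ Icc a b :=
  ⟨(h.mem_Icc hk.le).1.trans (h.tag k hk).1, (h.tag k hk).2.trans (h.mem_Icc hk).2⟩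

theorem exists_of_le (hab : a ≤ b) (hδ : 0 < δ) : ∃ m p τ, IsTaggedPartition a b δ m p τ := by
  obtain ⟨N, hN⟩ := exists_nat_gt ((b - a) / δ)
  have hN0 : (0 : ℝ) < N := lt_of_le_of_lt (div_nonneg (by linarith) hδ.le) hN
  have h0 : 0 ≤ (b - a) / N := div_nonneg (by linarith) hN0.le
  have h1 : (b - a) / N < δ := by
    rw [div_lt_iff₀ hδ] at hN
    rw [div_lt_iff₀ hN0]
    linarith
  refine ⟨N, fun k => a + k * ((b - a) / N), fun k => a + k * ((b - a) / N), ?_, ?_, ?_, ?_, ?_⟩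
  · simp
  · field_simp
    ring
  · intro k _
    push_cast
    linarith
  · intro k _
    push_cast
    linarith
  · intro k _
    push_cast
    exact ⟨le_rfl, by linarith⟩

/-- Two adjacent tagged partitions join to one, and the Riemann–Stieltjes sums add up. -/
theorem exists_concat (h₁ : IsTaggedPartition a c δ N q σ) (h₂ : IsTaggedPartition c b δ m p τ) :
    ∃ M P T, IsTaggedPartition a b δ M P T ∧
      ∀ (α : ℝ → Matrix (Fin n) (Fin n) 𝕜) (f : ℝ → Fin n → 𝕜),
        rsSum α f M P T = rsSum α f N q σ + rsSum α f m p τ := by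
  set P : ℕ → ℝ := fun k => if k < N then q k else p (k - N) with hP
  set T : ℕ → ℝ := fun k => if k < N then σ k else τ (k - N) with hT
  have hP1 : ∀ k ≤ N, P k = q k := by
    intro k hk
    rcases hk.lt_or_eq with hk | rfl
    · simp [hP, hk]
    · simp [hP, h₁.last, h₂.zero]
  have hP2 : ∀ k, P (N + k) = p k := fun k => by simp [hP]
  have hT1 : ∀ k < N, T k = σ k := fun k hk => by simp [hT, hk]
  have hT2 : ∀ k, T (N + k) = τ k := fun k => by simp [hT]
  have key : ∀ R : ℝ → ℝ → ℝ → Prop, (∀ k < N, R (q k) (q (k + 1)) (σ k)) →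
      (∀ k < m, R (p k) (p (k + 1)) (τ k)) → ∀ k < N + m, R (P k) (P (k + 1)) (T k) := by
    intro R hR1 hR2 k hk
    rcases lt_or_ge k N with h | h
    · rw [hP1 k h.le, hP1 (k + 1) h, hT1 k h]
      exact hR1 k h
    · obtain ⟨j, rfl⟩ := Nat.exists_eq_add_of_le h
      rw [add_assoc, hP2, hP2, hT2]
      exact hR2 j (by omega)
  refine ⟨N + m, P, T, ⟨?_, ?_, ?_, ?_, ?_⟩, ?_⟩
  · rw [hP1 0 (Nat.zero_le _), h₁.zero]
  · rw [hP2, h₂.last]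
  · exact key (fun x y _ => x ≤ y) h₁.le h₂.le
  · exact key (fun x y _ => y - x < δ) h₁.mesh h₂.mesh
  · exact key (fun x y t => t ∈ Icc x y) h₁.tag h₂.tag
  · intro α f
    unfold rsSum
    rw [Finset.sum_range_add]
    congr 1
    · refine Finset.sum_congr rfl fun k hk => ?_
      have hk := Finset.mem_range.mp hk
      rw [hP1 k hk.le, hP1 (k + 1) hk, hT1 k hk]
    · refine Finset.sum_congr rfl fun k _ => ?_
      rw [add_assoc, hP2, hP2, hT2]

end IsTaggedPartition

theorem rsSum_congr {α β : ℝ → Matrix (Fin n) (Fin n) 𝕜} {f g : ℝ → Fin n → 𝕜} {m : ℕ}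
    {p q τ σ : ℕ → ℝ} (hα : ∀ k ≤ m, α (p k) = β (q k)) (hf : ∀ k < m, f (τ k) = g (σ k)) :
    rsSum α f m p τ = rsSum β g m q σ :=
  Finset.sum_congr rfl fun k hk => by
    have hk := Finset.mem_range.mp hk
    rw [hα k hk.le, hα (k + 1) hk, hf k hk]

theorem rsSum_const (α : ℝ → Matrix (Fin n) (Fin n) 𝕜) (v : Fin n → 𝕜) (m : ℕ) (p τ : ℕ → ℝ) :
    rsSum α (fun _ => v) m p τ = (α (p m) - α (p 0)) *ᵥ v := by
  unfold rsSum
  rw [← Matrix.sum_mulVec, Finset.sum_range_sub (fun k => α (p k))]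

/-! ### Riemann–Stieltjes integrals -/

variable {α : ℝ → Matrix (Fin n) (Fin n) 𝕜} {f g : ℝ → Fin n → 𝕜} {a b c : ℝ} {I I' : Fin n → 𝕜}

/-- On an interval traversed from left to right, only increasing partitions matter. -/
theorem hasRSIntegral_iff (hab : a ≤ b) :
    HasRSIntegral α f a b I ↔ ∀ ε > 0, ∃ δ > 0, ∀ (m : ℕ) (p τ : ℕ → ℝ),
      IsTaggedPartition a b δ m p τ → ‖rsSum α f m p τ - I‖ < ε := by
  refine forall₂_congr fun ε _ => exists_congr fun δ => and_congr_right fun _ => ?_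
  constructor
  · intro h m p τ hp
    refine h m p τ hp.zero hp.last (.inl hp.le) (fun k hk => ?_) (fun k hk => ?_)
    · rw [abs_of_nonneg (sub_nonneg.mpr (hp.le k hk))]
      exact hp.mesh k hk
    · exact Icc_subset_uIcc (hp.tag k hk)
  · intro h m p τ h0 hm hmono hmesh htag
    -- a decreasing partition from `a` to `b ≥ a` is constant, hence also increasing
    have hle : ∀ k < m, p k ≤ p (k + 1) := by
      rcases hmono with hle | hge
      · exact hle
      · have hanti : ∀ j k, j ≤ k → k ≤ m → p k ≤ p j := by
          intro j k hjk
          induction k, hjk using Nat.le_induction with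
          | base => exact fun _ => le_rfl
          | succ k _ ih => exact fun hk => (hge k (by omega)).trans (ih (by omega))
        intro k hk
        have h1 := hanti 0 k (Nat.zero_le _) hk.le
        have h2 := hanti (k + 1) m hk le_rfl
        linarith
    refine h m p τ ⟨h0, hm, hle, fun k hk => (le_abs_self _).trans_lt (hmesh k hk), ?_⟩
    intro k hk
    rw [← uIcc_of_le (hle k hk)]
    exact htag k hk

theorem HasRSIntegral.unique_of_le (hab : a ≤ b) (h : HasRSIntegral α f a b I)
    (h' : HasRSIntegral α f a b I') : I = I' := by
  rw [hasRSIntegral_iff hab] at h h'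
  refine eq_of_forall_dist_le fun ε hε => ?_
  obtain ⟨δ, hδ, h⟩ := h (ε / 2) (by positivity)
  obtain ⟨δ', hδ', h'⟩ := h' (ε / 2) (by positivity)
  obtain ⟨m, p, τ, hp⟩ := IsTaggedPartition.exists_of_le hab (lt_min hδ hδ')
  have h1 := h m p τ { hp with mesh := fun k hk => (hp.mesh k hk).trans_le (min_le_left _ _) }
  have h2 := h' m p τ { hp with mesh := fun k hk => (hp.mesh k hk).trans_le (min_le_right _ _) }
  rw [← dist_eq_norm] at h1 h2
  have := dist_triangle_left I I' (rsSum α f m p τ)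
  linarith

theorem HasRSIntegral.comp_neg (h : HasRSIntegral α f a b I) :
    HasRSIntegral (fun θ => α (-θ)) (fun θ => f (-θ)) (-a) (-b) I := by
  intro ε hε
  obtain ⟨δ, hδ, h⟩ := h ε hε
  refine ⟨δ, hδ, fun m p τ h0 hm hmono hmesh htag => ?_⟩
  refine h m (fun k => -p k) (fun k => -τ k) (by simp [h0]) (by simp [hm]) ?_ ?_ ?_
  · rcases hmono with hle | hge
    · exact .inr fun k hk => neg_le_neg (hle k hk)
    · exact .inl fun k hk => neg_le_neg (hge k hk)
  · intro k hk
    have := hmesh k hk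
    rwa [← abs_neg, neg_sub, ← neg_sub_neg] at this
  · intro k hk
    have := htag k hk
    rw [mem_uIcc] at this ⊢
    rcases this with h | h
    · exact .inr ⟨neg_le_neg h.2, neg_le_neg h.1⟩
    · exact .inl ⟨neg_le_neg h.2, neg_le_neg h.1⟩

theorem HasRSIntegral.unique (h : HasRSIntegral α f a b I) (h' : HasRSIntegral α f a b I') :
    I = I' := by
  rcases le_total a b with hab | hba
  · exact h.unique_of_le hab h'
  · exact h.comp_neg.unique_of_le (neg_le_neg hba) h'.comp_neg

theorem HasRSIntegral.rsIntegrable (h : HasRSIntegral α f a b I) : RSIntegrable α f a b := ⟨I, h⟩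

theorem HasRSIntegral.rsIntegral_eq (h : HasRSIntegral α f a b I) :
    rsIntegral α f a b = I := by
  unfold rsIntegral
  rw [dif_pos h.rsIntegrable]
  exact h.rsIntegrable.choose_spec.unique h

theorem HasRSIntegral.congr (hab : a ≤ b) (h : HasRSIntegral α f a b I)
    (hfg : EqOn f g (Icc a b)) : HasRSIntegral α g a b I := by
  rw [hasRSIntegral_iff hab] at h ⊢
  intro ε hε
  obtain ⟨δ, hδ, h⟩ := h ε hε
  refine ⟨δ, hδ, fun m p τ hp => ?_⟩
  rw [← rsSum_congr (fun _ _ => rfl) fun k hk => hfg (hp.tag_mem_Icc hk)]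
  exact h m p τ hp

/-- Restriction to a right subinterval: `∫_a^b = ∫_a^c + ∫_c^b` for an integrand that is constant
on `[a, c]`. -/
theorem HasRSIntegral.restrict_right (hac : a ≤ c) (hcb : c ≤ b)
    (h : HasRSIntegral α (fun θ => f (max θ c)) a b I) :
    HasRSIntegral α f c b (I - (α c - α a) *ᵥ f c) := by
  rw [hasRSIntegral_iff (hac.trans hcb)] at h
  rw [hasRSIntegral_iff hcb]
  intro ε hε
  obtain ⟨δ, hδ, h⟩ := h ε hε
  refine ⟨δ, hδ, fun m p τ hp => ?_⟩
  obtain ⟨N, q, σ, hq⟩ := IsTaggedPartition.exists_of_le hac hδ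
  obtain ⟨M, P, T, hP, hsum⟩ := hq.exists_concat (𝕜 := 𝕜) (n := n) hp
  have h1 := h M P T hP
  rw [hsum, rsSum_congr (f := fun θ => f (max θ c)) (g := fun _ => f c) (m := N) (q := q) (σ := σ)
      (fun _ _ => rfl) (fun k hk => by rw [max_eq_right (hq.tag_mem_Icc hk).2]), rsSum_const,
    hq.zero, hq.last,
    rsSum_congr (f := fun θ => f (max θ c)) (g := f) (m := m) (q := p) (σ := τ)
      (fun _ _ => rfl) (fun k hk => by rw [max_eq_left (hp.tag_mem_Icc hk).1])] at h1
  convert h1 using 2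
  abel

/-- Restriction to a left subinterval: `∫_a^b = ∫_a^c + ∫_c^b` for an integrand that is constant
on `[c, b]`. -/
theorem HasRSIntegral.restrict_left (hac : a ≤ c) (hcb : c ≤ b)
    (h : HasRSIntegral α (fun θ => f (min θ c)) a b I) :
    HasRSIntegral α f a c (I - (α b - α c) *ᵥ f c) := by
  rw [hasRSIntegral_iff (hac.trans hcb)] at h
  rw [hasRSIntegral_iff hac]
  intro ε hε
  obtain ⟨δ, hδ, h⟩ := h ε hε
  refine ⟨δ, hδ, fun m p τ hp => ?_⟩
  obtain ⟨N, q, σ, hq⟩ := IsTaggedPartition.exists_of_le hcb hδ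
  obtain ⟨M, P, T, hP, hsum⟩ := hp.exists_concat (𝕜 := 𝕜) (n := n) hq
  have h1 := h M P T hP
  rw [hsum, rsSum_congr (f := fun θ => f (min θ c)) (g := fun _ => f c) (m := N) (q := q) (σ := σ)
      (fun _ _ => rfl) (fun k hk => by rw [min_eq_right (hq.tag_mem_Icc hk).1]), rsSum_const,
    hq.zero, hq.last,
    rsSum_congr (f := fun θ => f (min θ c)) (g := f) (m := m) (q := p) (σ := τ)
      (fun _ _ => rfl) (fun k hk => by rw [min_eq_left (hp.tag_mem_Icc hk).2])] at h1
  convert h1 using 2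
  abel

/-- If the integrator is constant to the left of `a`, the lower limit of integration may be moved
to the left. Clamping a partition of `[c, b]` to `[a, b]` changes at most the term whose interval
straddles `a`, and there the integrand varies little. -/
theorem HasRSIntegral.extend_left {V : ℝ → ℝ} (hV : Monotone V)
    (hαV : ∀ x y, x ≤ y → y ≤ b → ‖α y - α x‖ ≤ V y - V x) (hca : c ≤ a) (hab : a ≤ b)
    (hα : ∀ θ ≤ a, α θ = α a) (hf : ContinuousAt f a) (h : HasRSIntegral α f a b I) :
    HasRSIntegral α f c b I := by
  rw [hasRSIntegral_iff hab] at h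
  rw [hasRSIntegral_iff (hca.trans hab)]
  intro ε hε
  obtain ⟨δ₁, hδ₁, h⟩ := h (ε / 2) (by positivity)
  have hVpos : 0 < V b - V c + 1 := by linarith [hV (hca.trans hab)]
  set ω := ε / (2 * (V b - V c + 1)) with hω
  have hωpos : 0 < ω := by positivity
  obtain ⟨δ₂, hδ₂, hfδ⟩ := Metric.continuousAt_iff.mp hf ω hωpos
  refine ⟨min δ₁ δ₂, lt_min hδ₁ hδ₂, fun m p τ hp => ?_⟩
  have hα' : ∀ θ, α (max θ a) = α θ := fun θ => by
    rcases le_total θ a with h | h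
    · rw [max_eq_right h, hα θ h]
    · rw [max_eq_left h]
  have h1 := h m (fun k => max (p k) a) (fun k => max (τ k) a) ⟨by simp [hp.zero, hca],
    by simp [hp.last, hab], fun k hk => max_le_max_right a (hp.le k hk), fun k hk => by
      have h1 := max_sub_max_le_max (p (k + 1)) a (p k) a
      rw [sub_self, max_eq_left (sub_nonneg.mpr (hp.le k hk))] at h1
      exact h1.trans_lt ((hp.mesh k hk).trans_le (min_le_left _ _)),
    fun k hk => ⟨max_le_max_right a (hp.tag k hk).1, max_le_max_right a (hp.tag k hk).2⟩⟩
  have hterm : ∀ k ∈ Finset.range m,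
      ‖(α (p (k + 1)) - α (p k)) *ᵥ f (τ k) -
        (α (max (p (k + 1)) a) - α (max (p k) a)) *ᵥ f (max (τ k) a)‖ ≤
      (V (p (k + 1)) - V (p k)) * ω := by
    intro k hk
    have hk := Finset.mem_range.mp hk
    have hVk := hαV _ _ (hp.le k hk) (hp.mem_Icc (k := k + 1) hk).2
    have hVnn : 0 ≤ (V (p (k + 1)) - V (p k)) * ω :=
      mul_nonneg (sub_nonneg.mpr (hV (hp.le k hk))) hωpos.le
    rw [hα', hα', ← Matrix.mulVec_sub]
    rcases le_total a (τ k) with hτ | hτ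
    · rw [max_eq_left hτ, sub_self, Matrix.mulVec_zero, norm_zero]
      exact hVnn
    rcases le_total (p (k + 1)) a with hpa | hpa
    · rw [hα _ hpa, hα _ ((hp.le k hk).trans hpa), sub_self, Matrix.zero_mulVec, norm_zero]
      exact hVnn
    · have hmesh := (hp.mesh k hk).trans_le (min_le_right _ _)
      have htag := hp.tag k hk
      have hd : dist (τ k) a < δ₂ := by
        rw [Real.dist_eq, abs_sub_lt_iff]
        exact ⟨by linarith, by linarith [htag.1]⟩
      have hfd := (hfδ hd).le
      rw [dist_eq_norm] at hfd
      rw [max_eq_right hτ]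
      exact (Matrix.linfty_opNorm_mulVec _ _).trans
        (mul_le_mul hVk hfd (norm_nonneg _) ((norm_nonneg _).trans hVk))
  have h2 : ‖rsSum α f m p τ - rsSum α f m (fun k => max (p k) a) (fun k => max (τ k) a)‖ ≤
      (V b - V c) * ω := by
    rw [rsSum, rsSum, ← Finset.sum_sub_distrib]
    refine (norm_sum_le_of_le _ hterm).trans ?_
    rw [← Finset.sum_mul, Finset.sum_range_sub (fun k => V (p k)), hp.zero, hp.last]
  have h3 : (V b - V c) * ω < ε / 2 := by
    calc (V b - V c) * ω < (V b - V c + 1) * ω := by gcongr; linarith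
      _ = ε / 2 := by rw [hω]; field_simp
  have h4 := norm_sub_le_norm_sub_add_norm_sub (rsSum α f m p τ)
    (rsSum α f m (fun k => max (p k) a) (fun k => max (τ k) a)) I
  linarith

/-- A Riemann–Stieltjes integral taken over an interval on which the integrator is constant
vanishes, in whichever direction the interval is traversed. -/
theorem hasRSIntegral_zero_of_const (hα : ∀ θ ∈ uIcc a b, α θ = α a) :
    HasRSIntegral α f a b 0 := by
  intro ε hε
  refine ⟨1, one_pos, fun m p τ h0 hm hmono _ _ => ?_⟩
  have hmem : ∀ k ≤ m, p k ∈ uIcc a b := by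
    intro k hk
    rcases hmono with hle | hge
    · have hm' : ∀ i j, i ≤ j → j ≤ m → p i ≤ p j := by
        intro i j hij
        induction j, hij using Nat.le_induction with
        | base => exact fun _ => le_rfl
        | succ j _ ih => exact fun hj => (ih (by omega)).trans (hle j (by omega))
      rw [← h0, ← hm]
      exact Icc_subset_uIcc ⟨hm' 0 k (Nat.zero_le _) hk, hm' k m hk le_rfl⟩
    · have hm' : ∀ i j, i ≤ j → j ≤ m → p j ≤ p i := by
        intro i j hij
        induction j, hij using Nat.le_induction with
        | base => exact fun _ => le_rfl
        | succ j _ ih => exact fun hj => (hge j (by omega)).trans (ih (by omega))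
      rw [← h0, ← hm]
      exact Icc_subset_uIcc' ⟨hm' k m hk le_rfl, hm' 0 k (Nat.zero_le _) hk⟩
  have hz : ∑ k ∈ Finset.range m, (α (p (k + 1)) - α (p k)) *ᵥ f (τ k) = 0 :=
    Finset.sum_eq_zero fun k hk => by
      have hk := Finset.mem_range.mp hk
      rw [hα _ (hmem k hk.le), hα _ (hmem (k + 1) hk), sub_self, Matrix.zero_mulVec]
  rw [hz]
  simpa using hε

/-! ### Functions of bounded variation -/

theorem exists_monotoneOn_dist_le {E : Type*} [PseudoMetricSpace E] {f : ℝ → E} {s : Set ℝ}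
    (h : BoundedVariationOn f s) {a : ℝ} (ha : a ∈ s) :
    ∃ W : ℝ → ℝ, MonotoneOn W s ∧
      ∀ x ∈ s, ∀ y ∈ s, x ≤ y → dist (f y) (f x) ≤ W y - W x := by
  have hl := h.locallyBoundedVariationOn
  refine ⟨variationOnFromTo f s a, variationOnFromTo.monotoneOn hl ha, fun x hx y hy hxy => ?_⟩
  have h1 := variationOnFromTo.add hl ha hx hy
  have h2 : dist (f y) (f x) ≤ variationOnFromTo f s x y := by
    rw [variationOnFromTo.eq_of_le f s hxy]
    exact (h.mono inter_subset_left).dist_le ⟨hy, hxy, le_rfl⟩ ⟨hx, le_rfl, hxy⟩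
  linarith

/-- The derivative of a function of bounded variation is integrable: its norm is at most the
derivative of the variation function. -/
theorem locallyIntegrable_deriv_of_boundedVariationOn {E : Type*} [NormedAddCommGroup E]
    [NormedSpace ℝ E] [FiniteDimensional ℝ E] {f : ℝ → E} (h : BoundedVariationOn f univ) :
    LocallyIntegrable (deriv f) volume := by
  have : CompleteSpace E := FiniteDimensional.complete ℝ E
  obtain ⟨W, hW, hfW⟩ := exists_monotoneOn_dist_le h (mem_univ 0)
  have hWm : Monotone W := fun x y hxy => hW (mem_univ x) (mem_univ y) hxy
  have hle : ∀ᵐ x, ‖deriv f x‖ ≤ ‖deriv W x‖ := by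
    filter_upwards [h.locallyBoundedVariationOn.ae_differentiableAt, hWm.ae_differentiableAt]
      with x hfx hWx
    refine le_of_tendsto_of_tendsto hfx.hasDerivAt.tendsto_slope.norm
      hWx.hasDerivAt.tendsto_slope.norm (Filter.Eventually.of_forall fun y => ?_)
    change ‖slope f x y‖ ≤ ‖slope W x y‖
    rw [slope_def_module, slope_def_module, norm_smul, norm_smul]
    refine mul_le_mul_of_nonneg_left ?_ (norm_nonneg _)
    rw [← dist_eq_norm, Real.norm_eq_abs]
    rcases le_total x y with hxy | hxy
    · exact (hfW x trivial y trivial hxy).trans (le_abs_self _)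
    · rw [dist_comm, abs_sub_comm]
      exact (hfW y trivial x trivial hxy).trans (le_abs_self _)
  have hWi : LocallyIntegrable (deriv W) volume := fun x => by
    refine ⟨Icc (x - 1) (x + 1), Icc_mem_nhds (by linarith) (by linarith), ?_⟩
    rw [← intervalIntegrable_iff_integrableOn_Icc_of_le (by linarith)]
    exact (hWm.monotoneOn _).intervalIntegrable_deriv
  exact hWi.mono (aestronglyMeasurable_deriv f volume) hle

/-- A bounded linear map into `𝕜ⁿ` sends a curve of continuous functions whose pointwise
variations are uniformly bounded to a curve of bounded variation. In each coordinate the increments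
of the image are rotated to be nonnegative reals; by linearity their sum is the image of one
continuous function, whose norm is controlled by the pointwise variation. -/
theorem boundedVariationOn_clm_comp {X : Type*} [TopologicalSpace X] [CompactSpace X]
    (L : C(X, Fin n → 𝕜) →L[𝕜] (Fin n → 𝕜)) {γ : ℝ → C(X, Fin n → 𝕜)} {M : ℝ} (hM : 0 ≤ M)
    (hγ : ∀ (N : ℕ) (u : ℕ → ℝ), Monotone u → ∀ θ,
      ∑ i ∈ Finset.range N, ‖γ (u (i + 1)) θ - γ (u i) θ‖ ≤ M) :
    BoundedVariationOn (fun t => L (γ t)) univ := by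
  have hsum : ∀ (N : ℕ) (u : ℕ → ℝ), Monotone u →
      ∑ i ∈ Finset.range N, ‖L (γ (u (i + 1))) - L (γ (u i))‖ ≤ n * (‖L‖ * M) := by
    intro N u hu
    have hcoord : ∀ j : Fin n,
        ∑ i ∈ Finset.range N, ‖(L (γ (u (i + 1))) - L (γ (u i))) j‖ ≤ ‖L‖ * M := by
      intro j
      choose c hc1 hc2 using fun i : ℕ =>
        RCLike.exists_norm_eq_mul_self ((L (γ (u (i + 1))) - L (γ (u i))) j)
      set g : C(X, Fin n → 𝕜) :=
        ∑ i ∈ Finset.range N, c i • (γ (u (i + 1)) - γ (u i)) with hg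
      have hgM : ‖g‖ ≤ M := by
        rw [ContinuousMap.norm_le _ hM]
        intro θ
        rw [hg, ContinuousMap.sum_apply]
        refine (norm_sum_le _ _).trans (le_trans (Finset.sum_le_sum fun i _ => ?_) (hγ N u hu θ))
        rw [ContinuousMap.smul_apply, norm_smul, hc1, one_mul, ContinuousMap.sub_apply]
      have hLg : (L g) j =
          ((∑ i ∈ Finset.range N, ‖(L (γ (u (i + 1))) - L (γ (u i))) j‖ : ℝ) : 𝕜) := by
        rw [hg, map_sum, Finset.sum_apply, RCLike.ofReal_sum]
        refine Finset.sum_congr rfl fun i _ => ?_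
        rw [map_smul, map_sub, Pi.smul_apply, smul_eq_mul, hc2]
      have h1 : ‖(L g) j‖ ≤ ‖L‖ * M :=
        (norm_le_pi_norm _ j).trans
          ((L.le_opNorm g).trans (mul_le_mul_of_nonneg_left hgM (norm_nonneg L)))
      rw [hLg, RCLike.norm_ofReal] at h1
      exact (le_abs_self _).trans h1
    calc ∑ i ∈ Finset.range N, ‖L (γ (u (i + 1))) - L (γ (u i))‖
        ≤ ∑ i ∈ Finset.range N, ∑ j, ‖(L (γ (u (i + 1))) - L (γ (u i))) j‖ := by
          refine Finset.sum_le_sum fun i _ => ?_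
          rw [pi_norm_le_iff_of_nonneg (Finset.sum_nonneg fun _ _ => norm_nonneg _)]
          exact fun j => Finset.single_le_sum
            (f := fun j => ‖(L (γ (u (i + 1))) - L (γ (u i))) j‖)
            (fun _ _ => norm_nonneg _) (Finset.mem_univ j)
      _ = ∑ j, ∑ i ∈ Finset.range N, ‖(L (γ (u (i + 1))) - L (γ (u i))) j‖ := Finset.sum_comm
      _ ≤ ∑ _j : Fin n, ‖L‖ * M := Finset.sum_le_sum fun j _ => hcoord j
      _ = n * (‖L‖ * M) := by simp
  refine ne_top_of_le_ne_top (ENNReal.ofReal_ne_top (r := n * (‖L‖ * M))) (iSup_le ?_)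
  rintro ⟨N, u, hu, -⟩
  refine le_trans (le_of_eq ?_) (ENNReal.ofReal_le_ofReal (hsum N u hu))
  rw [ENNReal.ofReal_sum_of_nonneg fun _ _ => norm_nonneg _]
  exact Finset.sum_congr rfl fun i _ => by rw [edist_dist, dist_eq_norm]

/-! ### Translates of continuous functions -/

/-- The segment `θ ↦ g (t + θ)` in `C([-r, 0], 𝕜ⁿ)` of a continuous function `g` on `ℝ`. -/
def segment (r : ℝ) (g : C(ℝ, Fin n → 𝕜)) (t : ℝ) : C(Icc (-r) (0 : ℝ), Fin n → 𝕜) where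
  toFun θ := g (t + θ)

@[simp] theorem segment_apply (r : ℝ) (g : C(ℝ, Fin n → 𝕜)) (t : ℝ) (θ : Icc (-r) (0 : ℝ)) :
    segment r g t θ = g (t + θ) := rfl

theorem continuous_segment (r : ℝ) (g : C(ℝ, Fin n → 𝕜)) : Continuous (segment r g) :=
  ContinuousMap.continuous_of_continuous_uncurry _
    (g.continuous.comp (continuous_fst.add (continuous_subtype_val.comp continuous_snd)))

/-- The primitive `u ↦ ∫_0^u g` of a locally integrable function. -/
def primitive (g : ℝ → Fin n → 𝕜) (hg : ∀ a b, IntervalIntegrable g volume a b) :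
    C(ℝ, Fin n → 𝕜) where
  toFun u := ∫ s in (0 : ℝ)..u, g s
  continuous_toFun := intervalIntegral.continuous_primitive hg 0

@[simp] theorem primitive_apply (g : ℝ → Fin n → 𝕜) (hg : ∀ a b, IntervalIntegrable g volume a b)
    (u : ℝ) : primitive g hg u = ∫ s in (0 : ℝ)..u, g s := rfl

/-- The segments of a primitive of a continuous function form a `C¹` curve in `C([-r, 0], 𝕜ⁿ)`:
they are, up to a constant, the integral of the curve of segments of that function. -/
theorem hasDerivAt_segment_primitive (r : ℝ) (g : C(ℝ, Fin n → 𝕜)) (t : ℝ) :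
    HasDerivAt
      (segment r (primitive g fun a b => g.continuous.intervalIntegrable a b)) (segment r g t) t := by
  set P := primitive g fun a b => g.continuous.intervalIntegrable a b with hP
  have hi := fun a b => (continuous_segment r g).intervalIntegrable (μ := volume) a b
  have heq : segment r P = fun u => segment r P 0 + ∫ s in (0 : ℝ)..u, segment r g s := by
    funext u
    ext1 θ
    have h1 : (∫ s in (0 : ℝ)..u, segment r g s) θ = ∫ s in (0 : ℝ)..u, g (s + θ) := by
      have := (ContinuousMap.evalCLM ℝ (M := Fin n → 𝕜) θ).intervalIntegral_comp_comm (hi 0 u)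
      simpa using this.symm
    rw [ContinuousMap.add_apply, h1, segment_apply, segment_apply, hP, primitive_apply,
      primitive_apply, intervalIntegral.integral_comp_add_right (fun s => g s) (θ : ℝ), zero_add]
    exact (intervalIntegral.integral_add_adjacent_intervals
      (g.continuous.intervalIntegrable _ _) (g.continuous.intervalIntegrable _ _)).symm
  rw [heq]
  refine HasDerivAt.const_add _ (intervalIntegral.integral_hasDerivAt_right (hi 0 t)
    ((continuous_segment r g).stronglyMeasurableAtFilter _ _) (continuous_segment r g).continuousAt)

/-- If `g` is integrable, the segments of its primitive are mapped by `L` to a curve of bounded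
variation. -/
theorem boundedVariationOn_segment_primitive {r : ℝ}
    (L : C(Icc (-r) (0 : ℝ), Fin n → 𝕜) →L[𝕜] (Fin n → 𝕜)) {g : ℝ → Fin n → 𝕜}
    (hg : Integrable g) :
    BoundedVariationOn
      (fun t => L (segment r (primitive g fun _ _ => hg.intervalIntegrable) t)) univ := by
  refine boundedVariationOn_clm_comp L (M := ∫ s, ‖g s‖) (integral_nonneg fun _ => norm_nonneg _) ?_
  intro N u hu θ
  have hi : ∀ a b, IntervalIntegrable g volume a b := fun _ _ => hg.intervalIntegrable
  have hle : ∀ i, u i + θ ≤ u (i + 1) + θ := fun i => by linarith [hu (Nat.le_succ i)]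
  calc ∑ i ∈ Finset.range N, _
      ≤ ∑ i ∈ Finset.range N, ∫ s in (u i + θ)..(u (i + 1) + θ), ‖g s‖ := by
        refine Finset.sum_le_sum fun i _ => ?_
        rw [segment_apply, segment_apply, primitive_apply, primitive_apply,
          intervalIntegral.integral_interval_sub_left (hi _ _) (hi _ _)]
        exact intervalIntegral.norm_integral_le_integral_norm (hle i)
    _ = ∫ s in (u 0 + θ)..(u N + θ), ‖g s‖ :=
        intervalIntegral.sum_integral_adjacent_intervals (a := fun i => u i + θ)
          fun _ _ => (hi _ _).norm
    _ ≤ ∫ s, ‖g s‖ := by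
        rw [intervalIntegral.integral_of_le (by linarith [hu (Nat.zero_le N)])]
        exact setIntegral_le_integral hg.norm (Filter.Eventually.of_forall fun _ => norm_nonneg _)

/-! ### Integrals of approximate step functions -/

/-- If `e` takes values in `[0, 1]` and drops from `1` to `0` within distance `d` of `c`, then
`∫_a^b dα(θ) e(θ) v` differs from `(α c - α a) v` by at most `‖v‖` times the increment near `c` of a
monotone function `V` dominating the increments of `α`. The minimum covers the case `c < a`: then
the integral itself obeys the bound. -/
theorem norm_rsIntegral_step_sub_le {α : ℝ → Matrix (Fin n) (Fin n) 𝕜} {V e : ℝ → ℝ}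
    {a b c d : ℝ} {v I : Fin n → 𝕜} (hV : Monotone V)
    (hαV : ∀ x y, x ≤ y → y ≤ b → ‖α y - α x‖ ≤ V y - V x) (hab : a ≤ b) (hcb : c ≤ b)
    (hd : 0 < d) (he0 : ∀ θ, 0 ≤ e θ) (he1 : ∀ θ, e θ ≤ 1) (heL : ∀ θ ≤ c - d, e θ = 1)
    (heR : ∀ θ, c + d ≤ θ → e θ = 0) (hI : HasRSIntegral α (fun θ => e θ • v) a b I) :
    ‖I - (α c - α (min a c)) *ᵥ v‖ ≤ (V (c + 2 * d) - V (c - 2 * d)) * ‖v‖ := by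
  refine le_of_forall_pos_le_add fun ε hε => ?_
  rw [hasRSIntegral_iff hab] at hI
  obtain ⟨δ, hδ, hI⟩ := hI ε hε
  obtain ⟨m, p, τ, hp⟩ := IsTaggedPartition.exists_of_le hab (lt_min hδ hd)
  have h1 := hI m p τ { hp with mesh := fun k hk => (hp.mesh k hk).trans_le (min_le_left _ _) }
  set W : ℝ → ℝ := fun x => V (max (c - 2 * d) (min x (c + 2 * d))) with hW
  have hWm : Monotone W := fun x y hxy => hV (max_le_max_left _ (min_le_min_right _ hxy))
  have hterm : ∀ k ∈ Finset.range m,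
      ‖(α (p (k + 1)) - α (p k)) *ᵥ (e (τ k) • v) -
        (α (min (p (k + 1)) c) - α (min (p k) c)) *ᵥ v‖ ≤ (W (p (k + 1)) - W (p k)) * ‖v‖ := by
    intro k hk
    have hk := Finset.mem_range.mp hk
    have hle := hp.le k hk
    have hmesh := (hp.mesh k hk).trans_le (min_le_right _ _)
    have htag := hp.tag k hk
    have hyb := (hp.mem_Icc (k := k + 1) hk).2
    generalize p (k + 1) = y at *
    generalize p k = x at *
    generalize τ k = s at *
    have hnn : 0 ≤ (W y - W x) * ‖v‖ :=
      mul_nonneg (sub_nonneg.mpr (hWm hle)) (norm_nonneg v)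
    rcases le_or_gt y (c - d) with hy | hy
    · rw [heL s (htag.2.trans hy), one_smul, min_eq_left (by linarith), min_eq_left (by linarith),
        sub_self, norm_zero]
      exact hnn
    rcases le_or_gt (c + d) x with hx | hx
    · rw [heR s (hx.trans htag.1), zero_smul, Matrix.mulVec_zero, min_eq_right (by linarith),
        min_eq_right (by linarith), sub_self, Matrix.zero_mulVec, sub_self, norm_zero]
      exact hnn
    have hWx : W x = V x := by
      simp only [hW]
      rw [min_eq_left (by linarith), max_eq_right (by linarith)]
    have hWy : W y = V y := by
      simp only [hW]
      rw [min_eq_left (by linarith), max_eq_right (by linarith)]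
    rw [hWx, hWy]
    -- split the increment of `α` into its parts to the right and to the left of `c`
    set A := (α y - α x) - (α (min y c) - α (min x c)) with hA
    set B := α (min y c) - α (min x c) with hB
    have hAB : ‖A‖ + ‖B‖ ≤ V y - V x := by
      rcases le_total y c with hyc | hcy
      · rw [hA, hB, min_eq_left hyc, min_eq_left (hle.trans hyc), sub_self, norm_zero, zero_add]
        exact hαV x y hle hyb
      rcases le_total c x with hcx | hxc
      · rw [hA, hB, min_eq_right hcy, min_eq_right hcx, sub_self, sub_zero, norm_zero, add_zero]
        exact hαV x y hle hyb
      · have h1 := hαV x c hxc hcb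
        have h2 := hαV c y hcy hyb
        rw [hA, hB, min_eq_right hcy, min_eq_left hxc, sub_sub_sub_cancel_right]
        linarith
    have hsplit : (α y - α x) *ᵥ (e s • v) - B *ᵥ v = e s • (A *ᵥ v) - (1 - e s) • (B *ᵥ v) := by
      have : α y - α x = A + B := by rw [hA]; abel
      rw [this, Matrix.mulVec_smul, Matrix.add_mulVec]
      module
    rw [hsplit]
    calc ‖e s • (A *ᵥ v) - (1 - e s) • (B *ᵥ v)‖
        ≤ ‖e s • (A *ᵥ v)‖ + ‖(1 - e s) • (B *ᵥ v)‖ := norm_sub_le _ _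
      _ ≤ ‖A *ᵥ v‖ + ‖B *ᵥ v‖ := by
          rw [norm_smul, norm_smul, Real.norm_of_nonneg (he0 s),
            Real.norm_of_nonneg (by linarith [he1 s])]
          exact add_le_add (mul_le_of_le_one_left (norm_nonneg _) (he1 s))
            (mul_le_of_le_one_left (norm_nonneg _) (by linarith [he0 s]))
      _ ≤ ‖A‖ * ‖v‖ + ‖B‖ * ‖v‖ :=
          add_le_add (Matrix.linfty_opNorm_mulVec A v) (Matrix.linfty_opNorm_mulVec B v)
      _ = (‖A‖ + ‖B‖) * ‖v‖ := by ring
      _ ≤ (V y - V x) * ‖v‖ := mul_le_mul_of_nonneg_right hAB (norm_nonneg v)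
  have htel : (α c - α (min a c)) *ᵥ v =
      ∑ k ∈ Finset.range m, (α (min (p (k + 1)) c) - α (min (p k) c)) *ᵥ v := by
    rw [← Matrix.sum_mulVec, Finset.sum_range_sub (fun k => α (min (p k) c)), hp.zero, hp.last,
      min_eq_right hcb]
  have h2 : ‖rsSum α (fun θ => e θ • v) m p τ - (α c - α (min a c)) *ᵥ v‖ ≤
      (V (c + 2 * d) - V (c - 2 * d)) * ‖v‖ := by
    rw [htel, rsSum, ← Finset.sum_sub_distrib]
    refine (norm_sum_le_of_le _ hterm).trans ?_
    rw [← Finset.sum_mul, Finset.sum_range_sub (fun k => W (p k))]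
    refine mul_le_mul_of_nonneg_right (sub_le_sub (hV ?_) (hV (le_max_left _ _))) (norm_nonneg v)
    exact max_le (by linarith) (min_le_right _ _)
  rw [← norm_neg, neg_sub] at h1
  calc ‖I - (α c - α (min a c)) *ᵥ v‖
      = ‖(rsSum α (fun θ => e θ • v) m p τ - (α c - α (min a c)) *ᵥ v) +
          (I - rsSum α (fun θ => e θ • v) m p τ)‖ := by congr 1; abel
    _ ≤ _ := (norm_add_le _ _).trans (add_le_add h2 h1.le)

/-! ### The functional `L` and its integrator -/

section Represents

variable {r : ℝ} {hr : 0 < r} {η : ℝ → Matrix (Fin n) (Fin n) 𝕜}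
  {L : C(Icc (-r) (0 : ℝ), Fin n → 𝕜) →L[𝕜] (Fin n → 𝕜)}

theorem Represents.exists_monotone (hη : Represents hr η L) :
    ∃ V : ℝ → ℝ, Monotone V ∧ ∀ x y, x ≤ y → y ≤ 0 → ‖η y - η x‖ ≤ V y - V x := by
  have hr' : -r ≤ 0 := by linarith
  obtain ⟨W, hW, hηW⟩ := exists_monotoneOn_dist_le hη.boundedVariationOn (left_mem_Icc.mpr hr')
  have hmem : ∀ x, max (-r) (min x 0) ∈ Icc (-r) 0 := fun x =>
    ⟨le_max_left _ _, max_le hr' (min_le_right _ _)⟩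
  have hmono : Monotone fun x : ℝ => max (-r) (min x 0) := fun x y hxy =>
    max_le_max_left _ (min_le_min_right _ hxy)
  have hclamp : ∀ x ≤ 0, η (max (-r) (min x 0)) = η x := by
    intro x hx
    rw [min_eq_left hx]
    rcases le_total x (-r) with h | h
    · rw [max_eq_left h, hη.const x h]
    · rw [max_eq_right h]
  refine ⟨fun x => W (max (-r) (min x 0)), fun x y hxy => hW (hmem x) (hmem y) (hmono hxy), ?_⟩
  intro x y hxy hy
  rw [← hclamp x (hxy.trans hy), ← hclamp y hy, ← dist_eq_norm]
  exact hηW _ (hmem x) _ (hmem y) (hmono hxy)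

theorem Represents.hasRSIntegral_of_eq (hη : Represents hr η L)
    (ψ : C(Icc (-r) (0 : ℝ), Fin n → 𝕜)) {f : ℝ → Fin n → 𝕜}
    (hf : ∀ θ : Icc (-r) (0 : ℝ), ψ θ = f θ) : HasRSIntegral η f (-r) 0 (L ψ) :=
  (hη.hasRSIntegral ψ).congr (by linarith) fun θ hθ => by
    rw [IccExtend_of_mem _ _ hθ, hf]

/-- `∫_{-t}^0 dη(θ) y(t + θ)` for a function `y` that is continuous on `[0, ∞)`, expressed through
the segment of the continuous extension `g` of `y` that is constant on `(-∞, 0]`. -/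
theorem Represents.hasRSIntegral_translate (hη : Represents hr η L) {y : ℝ → Fin n → 𝕜}
    (g : C(ℝ, Fin n → 𝕜)) (hg : ∀ u, g u = y (max u 0)) {t : ℝ} (ht : 0 ≤ t) :
    HasRSIntegral η (fun θ => y (t + θ)) (-t) 0
      (L (segment r g t) - (η (-t) - η (-r)) *ᵥ y 0) := by
  obtain ⟨V, hV, hηV⟩ := hη.exists_monotone
  have h1 : HasRSIntegral η (fun θ => g (t + θ)) (-r) 0 (L (segment r g t)) :=
    hη.hasRSIntegral_of_eq _ fun _ => rfl
  have h2 : HasRSIntegral η (fun θ => g (t + θ)) (-max t r) 0 (L (segment r g t)) :=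
    h1.extend_left hV hηV (neg_le_neg (le_max_right t r)) (by linarith) hη.const
      (g.continuous.comp (continuous_const.add continuous_id)).continuousAt
  have h3 : ∀ θ, g (t + θ) = y (t + max θ (-t)) := fun θ => by
    rw [hg, ← max_add_add_left, add_neg_cancel]
  simp only [h3] at h2
  have h4 := HasRSIntegral.restrict_right (f := fun θ => y (t + θ))
    (neg_le_neg (le_max_left t r)) (neg_nonpos.mpr ht) h2
  rwa [hη.const (-max t r) (neg_le_neg (le_max_right t r)), add_neg_cancel] at h4

/-- The ramp `u ↦ min(u, 0) v`. -/
def ramp (v : Fin n → 𝕜) : C(ℝ, Fin n → 𝕜) where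
  toFun u := min u 0 • v

@[simp] theorem ramp_apply (v : Fin n → 𝕜) (u : ℝ) : ramp v u = min u 0 • v := rfl

/-- Difference quotients of a ramp are approximate step functions, so `t ↦ L (ramp_t)` has
derivative `(η(-t) - η(-r)) v` wherever the variation of `η` is continuous. -/
theorem Represents.ae_hasDerivAt_ramp (hη : Represents hr η L) (v : Fin n → 𝕜) :
    ∀ᵐ t ∂volume.restrict (Ici (0 : ℝ)),
      HasDerivAt (fun t => L (segment r (ramp v) t)) ((η (-t) - η (-r)) *ᵥ v) t := by
  obtain ⟨V, hV, hηV⟩ := hη.exists_monotone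
  have hVneg : Antitone fun t => V (-t) := fun x y hxy => hV (neg_le_neg hxy)
  filter_upwards [ae_restrict_mem measurableSet_Ici,
    ae_restrict_of_ae (hVneg.countable_not_continuousAt.ae_notMem volume)] with t ht hcont
  have ht : 0 ≤ t := ht
  have hcont : ContinuousAt (fun t => V (-t)) t := not_not.mp hcont
  have hmin : η (min (-r) (-t)) = η (-r) := hη.const _ (min_le_left _ _)
  rw [hasDerivAt_iff_tendsto_slope_zero, tendsto_iff_norm_sub_tendsto_zero]
  have hbound : ∀ h : ℝ, h ≠ 0 →
      ‖h⁻¹ • (L (segment r (ramp v) (t + h)) - L (segment r (ramp v) t)) -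
        (η (-t) - η (-r)) *ᵥ v‖ ≤ (V (-(t - 2 * |h|)) - V (-(t + 2 * |h|))) * ‖v‖ := by
    intro h hh
    set e : ℝ → ℝ := fun θ => h⁻¹ * (min (t + h + θ) 0 - min (t + θ) 0) with he
    have hI : HasRSIntegral η (fun θ => e θ • v) (-r) 0
        (h⁻¹ • (L (segment r (ramp v) (t + h)) - L (segment r (ramp v) t))) := by
      have h1 : h⁻¹ • (L (segment r (ramp v) (t + h)) - L (segment r (ramp v) t)) =
          L (h⁻¹ • (segment r (ramp v) (t + h) - segment r (ramp v) t)) := by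
        rw [← map_sub]
        exact ((L.restrictScalars ℝ).map_smul _ _).symm
      rw [h1]
      refine hη.hasRSIntegral_of_eq _ fun θ => ?_
      simp only [ContinuousMap.smul_apply, ContinuousMap.sub_apply, segment_apply, ramp_apply, he]
      rw [← sub_smul, smul_smul]
    have key := norm_rsIntegral_step_sub_le (c := -t) hV hηV (by linarith : -r ≤ 0) (by linarith)
      (abs_pos.mpr hh) ?_ ?_ ?_ ?_ hI
    · rw [hmin] at key
      convert key using 4 <;> ring
    · intro θ
      rcases hh.lt_or_gt with h0 | h0
      · exact mul_nonneg_of_nonpos_of_nonpos (inv_nonpos.mpr h0.le)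
          (sub_nonpos.mpr (min_le_min_right _ (by linarith)))
      · exact mul_nonneg (inv_nonneg.mpr h0.le)
          (sub_nonneg.mpr (min_le_min_right _ (by linarith)))
    · intro θ
      simp only [he]
      rcases hh.lt_or_gt with h0 | h0
      · have : h ≤ min (t + h + θ) 0 - min (t + θ) 0 := by
          rcases le_total (t + h + θ) 0 with h1 | h1
          · rw [min_eq_left h1]
            linarith [min_le_left (t + θ) 0]
          · rw [min_eq_right h1]
            linarith [min_le_right (t + θ) 0]
        rw [inv_mul_eq_div]
        exact (div_le_one_of_neg h0).mpr this
      · have : min (t + h + θ) 0 - min (t + θ) 0 ≤ h := by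
          rcases le_total (t + θ) 0 with h1 | h1
          · rw [min_eq_left h1]
            linarith [min_le_left (t + h + θ) 0]
          · rw [min_eq_right h1]
            linarith [min_le_right (t + h + θ) 0]
        rw [inv_mul_eq_div]
        exact (div_le_one h0).mpr this
    · intro θ hθ
      have h1 := neg_abs_le h
      have h2 := le_abs_self h
      simp only [he]
      rw [min_eq_left (by linarith), min_eq_left (by linarith [abs_nonneg h]),
        show t + h + θ - (t + θ) = h by ring, inv_mul_cancel₀ hh]
    · intro θ hθ
      have h1 := neg_abs_le h
      simp only [he]
      rw [min_eq_right (by linarith), min_eq_right (by linarith [abs_nonneg h]), sub_self, mul_zero]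
  have hlim : Filter.Tendsto (fun h : ℝ => (V (-(t - 2 * |h|)) - V (-(t + 2 * |h|))) * ‖v‖)
      (nhdsWithin 0 {0}ᶜ) (nhds 0) := by
    have h1 : Filter.Tendsto (fun h : ℝ => t - 2 * |h|) (nhds 0) (nhds t) := by
      have : Continuous fun h : ℝ => t - 2 * |h| := by fun_prop
      simpa using this.tendsto 0
    have h2 : Filter.Tendsto (fun h : ℝ => t + 2 * |h|) (nhds 0) (nhds t) := by
      have : Continuous fun h : ℝ => t + 2 * |h| := by fun_prop
      simpa using this.tendsto 0
    have h3 := ((hcont.tendsto.comp h1).sub (hcont.tendsto.comp h2)).mul_const ‖v‖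
    rw [sub_self, zero_mul] at h3
    exact h3.mono_left nhdsWithin_le_nhds
  refine squeeze_zero' (Filter.Eventually.of_forall fun _ => norm_nonneg _) ?_ hlim
  filter_upwards [self_mem_nhdsWithin] with h hh using hbound h hh

end Represents

/-! ### The forcing term -/

section Forcing

variable {r : ℝ} {φ : ℝ → Fin n → 𝕜}

theorem integrable_history (hφ : IntegrableOn φ (Icc (-r) 0)) :
    Integrable ((Icc (-r) (0 : ℝ)).indicator φ) :=
  (integrable_indicator_iff measurableSet_Icc).mpr hφ

/-- The primitive, vanishing on `[0, ∞)`, of the history `φ` extended by zero to `ℝ`. -/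
def historyPrimitive (hφ : IntegrableOn φ (Icc (-r) 0)) : C(ℝ, Fin n → 𝕜) :=
  primitive ((Icc (-r) (0 : ℝ)).indicator φ) fun _ _ => (integrable_history hφ).intervalIntegrable

theorem historyPrimitive_of_nonneg (hφ : IntegrableOn φ (Icc (-r) 0)) {u : ℝ} (hu : 0 ≤ u) :
    historyPrimitive hφ u = 0 := by
  rw [historyPrimitive, primitive_apply, intervalIntegral.integral_of_le hu]
  exact setIntegral_eq_zero_of_forall_eq_zero fun s hs =>
    indicator_of_notMem (fun h => absurd h.2 (not_le.mpr hs.1)) _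

/-- On `[-r, 0]` the history may be changed on a null set. -/
theorem historyPrimitive_of_mem (hφ : IntegrableOn φ (Icc (-r) 0)) {y : ℝ → Fin n → 𝕜}
    (hy : ∀ᵐ s ∂volume.restrict (Icc (-r) 0), y s = φ s) {u : ℝ} (hu : u ∈ Icc (-r) 0) :
    historyPrimitive hφ u = ∫ s in (0 : ℝ)..u, y s := by
  rw [historyPrimitive, primitive_apply]
  refine intervalIntegral.integral_congr_ae ?_
  filter_upwards [(ae_restrict_iff' measurableSet_Icc).mp hy] with s hs hsu
  rw [uIoc_of_ge hu.2] at hsu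
  have hs' : s ∈ Icc (-r) 0 := ⟨hu.1.trans hsu.1.le, hsu.2⟩
  rw [indicator_of_mem hs', hs hs']

variable {hr : 0 < r} {η : ℝ → Matrix (Fin n) (Fin n) 𝕜}
  {L : C(Icc (-r) (0 : ℝ), Fin n → 𝕜) →L[𝕜] (Fin n → 𝕜)}

theorem Represents.hasRSIntegral_integrandG₁ (hη : Represents hr η L)
    (hφ : IntegrableOn φ (Icc (-r) 0)) :
    HasRSIntegral η (integrandG₁ φ) (-r) 0 (-L (segment r (historyPrimitive hφ) 0)) := by
  rw [← map_neg]
  refine hη.hasRSIntegral_of_eq _ fun θ => ?_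
  rw [ContinuousMap.neg_apply, segment_apply, zero_add,
    historyPrimitive_of_mem hφ (Filter.Eventually.of_forall fun _ => rfl) θ.2, integrandG₁,
    intervalIntegral.integral_symm, neg_neg]

theorem Represents.hasRSIntegral_integrandG₂ (hη : Represents hr η L)
    (hφ : IntegrableOn φ (Icc (-r) 0)) {t : ℝ} (ht : 0 ≤ t) :
    HasRSIntegral η (integrandG₂ φ t) (-r) (-t) (L (segment r (historyPrimitive hφ) t)) := by
  rcases le_total t r with htr | hrt
  · have hae : ∀ᵐ s ∂volume.restrict (Icc (-r) 0), staticProlongation φ s = φ s := by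
      filter_upwards [ae_restrict_mem measurableSet_Icc, ae_restrict_of_ae
        (measure_eq_zero_iff_ae_notMem.mp (Real.volume_singleton (a := 0)))] with s hs hs0
      exact if_neg (not_le.mpr (lt_of_le_of_ne hs.2 hs0))
    have h1 : HasRSIntegral η (fun θ => integrandG₂ φ t (min θ (-t))) (-r) 0
        (L (segment r (historyPrimitive hφ) t)) := by
      refine hη.hasRSIntegral_of_eq _ fun θ => ?_
      rw [segment_apply, integrandG₂, ← min_add_add_left, add_neg_cancel]
      rcases le_total (t + θ) 0 with h | h
      · rw [min_eq_left h]
        exact historyPrimitive_of_mem hφ hae ⟨by linarith [θ.2.1], h⟩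
      · rw [min_eq_right h, intervalIntegral.integral_same, historyPrimitive_of_nonneg hφ h]
    have h2 := h1.restrict_left (neg_le_neg htr) (by linarith)
    have h3 : integrandG₂ φ t (-t) = 0 := by simp [integrandG₂]
    rwa [h3, Matrix.mulVec_zero, sub_zero] at h2
  · have h1 : segment r (historyPrimitive hφ) t = 0 := by
      ext1 θ
      exact historyPrimitive_of_nonneg hφ (by linarith [θ.2.1])
    rw [h1, map_zero]
    refine hasRSIntegral_zero_of_const fun θ hθ => hη.const θ ?_
    rw [uIcc_of_ge (neg_le_neg hrt)] at hθ
    exact hθ.2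

theorem Represents.G_eq (hη : Represents hr η L) (hφ : IntegrableOn φ (Icc (-r) 0)) {t : ℝ}
    (ht : 0 ≤ t) :
    G r η φ t = -L (segment r (historyPrimitive hφ) 0) + L (segment r (historyPrimitive hφ) t) := by
  rw [G, (hη.hasRSIntegral_integrandG₁ hφ).rsIntegral_eq,
    (hη.hasRSIntegral_integrandG₂ hφ ht).rsIntegral_eq]

/-- The forcing term `f(·; φ)`: the derivative of `G(·; φ)`, cut off at `r`, after which
`G(·; φ)` is constant. -/
def forcing (L : C(Icc (-r) (0 : ℝ), Fin n → 𝕜) →L[𝕜] (Fin n → 𝕜))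
    (hφ : IntegrableOn φ (Icc (-r) 0)) : ℝ → Fin n → 𝕜 :=
  (Iio r).indicator (deriv fun t => L (segment r (historyPrimitive hφ) t))

theorem locallyIntegrable_forcing (L : C(Icc (-r) (0 : ℝ), Fin n → 𝕜) →L[𝕜] (Fin n → 𝕜))
    (hφ : IntegrableOn φ (Icc (-r) 0)) : LocallyIntegrable (forcing L hφ) := by
  have h := locallyIntegrable_deriv_of_boundedVariationOn
    (boundedVariationOn_segment_primitive L (integrable_history hφ))
  refine h.mono (h.aestronglyMeasurable.indicator measurableSet_Iio) ?_
  exact Filter.Eventually.of_forall fun t => norm_indicator_le_norm_self _ _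

theorem Represents.ae_hasDerivWithinAt_G (hη : Represents hr η L)
    (hφ : IntegrableOn φ (Icc (-r) 0)) :
    ∀ᵐ t ∂volume.restrict (Ici (0 : ℝ)),
      HasDerivWithinAt (G r η φ) (forcing L hφ t) (Ici 0) t := by
  have hbv := boundedVariationOn_segment_primitive L (integrable_history hφ)
  filter_upwards [ae_restrict_mem measurableSet_Ici,
    ae_restrict_of_ae hbv.locallyBoundedVariationOn.ae_differentiableAt,
    ae_restrict_of_ae (measure_eq_zero_iff_ae_notMem.mp (Real.volume_singleton (a := r)))]
    with t ht hdiff htr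
  have hd : deriv (fun t => L (segment r (historyPrimitive hφ) t)) t = forcing L hφ t := by
    rcases lt_or_gt_of_ne htr with h | h
    · exact (indicator_of_mem (s := Iio r) h _).symm
    · rw [forcing, indicator_of_notMem (notMem_Iio.mpr h.le)]
      have : (fun t => L (segment r (historyPrimitive hφ) t)) =ᶠ[nhds t] fun _ => 0 := by
        filter_upwards [lt_mem_nhds h] with s hs
        have h1 : segment r (historyPrimitive hφ) s = 0 := by
          ext1 θ
          exact historyPrimitive_of_nonneg hφ (by linarith [θ.2.1])
        rw [h1, map_zero]
      rw [this.deriv_eq, deriv_const]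
  rw [← hd]
  exact (hdiff.hasDerivAt.hasDerivWithinAt.const_add
    (-L (segment r (historyPrimitive hφ) 0))).congr (fun s hs => hη.G_eq hφ hs) (hη.G_eq hφ ht)

end Forcing

/-! ### Mild solutions -/

section MildSolution

variable {r : ℝ} {φ x : ℝ → Fin n → 𝕜} {L : C(Icc (-r) (0 : ℝ), Fin n → 𝕜) →L[𝕜] (Fin n → 𝕜)}

theorem intervalIntegrable_indicator_Ici {y : ℝ → Fin n → 𝕜}
    (hy : LocallyIntegrableOn y (Ici (-r))) (a b : ℝ) :
    IntervalIntegrable ((Ici (-r)).indicator y) volume a b := by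
  rw [intervalIntegrable_iff', IntegrableOn, integrable_indicator_iff measurableSet_Ici,
    IntegrableOn, Measure.restrict_restrict measurableSet_Ici]
  refine (hy.integrableOn_compact_subset (t := Icc (-r) (max a b)) Icc_subset_Ici_self
    isCompact_Icc).mono_set
    fun s hs => ⟨hs.1, hs.2.2⟩

/-- `∫_0^t x_s ds` is the increment of the segments of a primitive of `x`. -/
theorem historyIntegral_eq (hx : LocallyIntegrableOn x (Ici (-r))) {t : ℝ} (ht : 0 ≤ t) :
    historyIntegral hx ht =
      segment r (primitive _ (intervalIntegrable_indicator_Ici hx)) t -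
        segment r (primitive _ (intervalIntegrable_indicator_Ici hx)) 0 := by
  ext1 θ
  have hi := intervalIntegrable_indicator_Ici hx
  change ∫ s in (0 : ℝ)..t, x (s + θ) = _
  rw [ContinuousMap.sub_apply, segment_apply, segment_apply, primitive_apply, primitive_apply,
    intervalIntegral.integral_interval_sub_left (hi _ _) (hi _ _), zero_add,
    intervalIntegral.integral_comp_add_right (fun s => x s) (θ : ℝ), zero_add]
  refine intervalIntegral.integral_congr fun s hs => ?_
  rw [uIcc_of_le (by linarith)] at hs
  exact (indicator_of_mem (s := Ici (-r)) (θ.2.1.trans hs.1) _).symm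

theorem IsMildSolution.continuous_comp_max (h : IsMildSolution L φ x) :
    Continuous fun u => x (max u 0) := by
  have heq : (fun u => x (max u 0)) = fun u => φ 0 +
      L (segment r (primitive _ (intervalIntegrable_indicator_Ici h.locallyIntegrableOn))
          (max u 0) -
        segment r (primitive _ (intervalIntegrable_indicator_Ici h.locallyIntegrableOn)) 0) := by
    funext u
    rw [h.eq_of_nonneg _ (le_max_right u 0), historyIntegral_eq]
  rw [heq]
  exact continuous_const.add (L.continuous.comp
    (((continuous_segment _ _).comp (continuous_id.max continuous_const)).sub continuous_const))

/-- The continuous extension of `x|_{[0, ∞)}` to `ℝ` that is constant on `(-∞, 0]`. -/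
def IsMildSolution.extension (h : IsMildSolution L φ x) : C(ℝ, Fin n → 𝕜) where
  toFun u := x (max u 0)
  continuous_toFun := h.continuous_comp_max

theorem IsMildSolution.extension_apply (h : IsMildSolution L φ x) (u : ℝ) :
    h.extension u = x (max u 0) := rfl

/-- The primitive of the continuous extension of `x|_{[0, ∞)}`. -/
def IsMildSolution.extensionPrimitive (h : IsMildSolution L φ x) : C(ℝ, Fin n → 𝕜) :=
  primitive h.extension fun _ _ => h.extension.continuous.intervalIntegrable _ _

theorem IsMildSolution.extensionPrimitive_of_nonpos (h : IsMildSolution L φ x) {u : ℝ}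
    (hu : u ≤ 0) : h.extensionPrimitive u = ramp (x 0) u := by
  have h1 : ∫ s in (0 : ℝ)..u, h.extension s = ∫ _s in (0 : ℝ)..u, x 0 := by
    refine intervalIntegral.integral_congr fun s hs => ?_
    rw [uIcc_of_ge hu] at hs
    rw [h.extension_apply, max_eq_right hs.2]
  rw [IsMildSolution.extensionPrimitive, primitive_apply, h1, intervalIntegral.integral_const,
    sub_zero, ramp_apply, min_eq_left hu]

/-- A primitive of `x` splits into a primitive of the history, a `C¹` function, and a ramp that
cancels the latter on `[-r, 0]`. -/
theorem IsMildSolution.primitive_eq (hr : 0 ≤ r) (h : IsMildSolution L φ x)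
    (hφ : IntegrableOn φ (Icc (-r) 0)) {u : ℝ} (hu : -r ≤ u) :
    primitive _ (intervalIntegrable_indicator_Ici h.locallyIntegrableOn) u =
      historyPrimitive hφ u + h.extensionPrimitive u - ramp (x 0) u := by
  rcases le_total u 0 with hu0 | hu0
  · rw [h.extensionPrimitive_of_nonpos hu0, add_sub_cancel_right, primitive_apply]
    refine (historyPrimitive_of_mem hφ ?_ ⟨hu, hu0⟩).symm
    filter_upwards [h.ae_eq_history, ae_restrict_mem measurableSet_Icc] with s hs hsr
    rw [indicator_of_mem (s := Ici (-r)) hsr.1, hs]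
  · rw [historyPrimitive_of_nonneg hφ hu0, zero_add, ramp_apply, min_eq_right hu0, zero_smul,
      sub_zero, primitive_apply, IsMildSolution.extensionPrimitive, primitive_apply]
    refine intervalIntegral.integral_congr_ae (Filter.Eventually.of_forall fun s hs => ?_)
    rw [uIoc_of_le hu0] at hs
    rw [h.extension_apply, max_eq_left hs.1.le]
    exact indicator_of_mem (s := Ici (-r)) ((neg_nonpos.mpr hr).trans hs.1.le) _

/-- The mild equation with the contribution of the history, collected in `G`, separated from that
of the values of the solution on `[0, ∞)`. -/
theorem IsMildSolution.eq_G_add {η : ℝ → Matrix (Fin n) (Fin n) 𝕜} {hr : 0 < r}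
    (h : IsMildSolution L φ x) (hη : Represents hr η L) (hφ : IntegrableOn φ (Icc (-r) 0)) {t : ℝ}
    (ht : 0 ≤ t) :
    x t = φ 0 + (G r η φ t + (L (segment r h.extensionPrimitive t) -
      L (segment r (ramp (x 0)) t))) := by
  have hseg : segment r (primitive _ (intervalIntegrable_indicator_Ici h.locallyIntegrableOn)) t =
      segment r (historyPrimitive hφ) t + segment r h.extensionPrimitive t -
        segment r (ramp (x 0)) t := by
    ext1 θ
    exact h.primitive_eq hr.le hφ (by linarith [θ.2.1])
  have hseg0 : segment r (primitive _ (intervalIntegrable_indicator_Ici h.locallyIntegrableOn)) 0 =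
      segment r (historyPrimitive hφ) 0 := by
    ext1 θ
    rw [segment_apply, h.primitive_eq hr.le hφ (by linarith [θ.2.1]),
      h.extensionPrimitive_of_nonpos (by linarith [θ.2.2]), add_sub_cancel_right, segment_apply]
  rw [h.eq_of_nonneg t ht, historyIntegral_eq, hseg, hseg0, hη.G_eq hφ ht]
  simp only [map_add, map_sub]
  abel

theorem IsMildSolution.hasDerivAt_extensionPrimitive (h : IsMildSolution L φ x) (t : ℝ) :
    HasDerivAt (fun t => L (segment r h.extensionPrimitive t)) (L (segment r h.extension t)) t :=
  (L.restrictScalars ℝ).hasFDerivAt.comp_hasDerivAt t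
    (hasDerivAt_segment_primitive r h.extension t)

theorem IsMildSolution.ae_hasDerivWithinAt {η : ℝ → Matrix (Fin n) (Fin n) 𝕜} {hr : 0 < r}
    (h : IsMildSolution L φ x) (hη : Represents hr η L) (hφ : IntegrableOn φ (Icc (-r) 0)) :
    ∀ᵐ t ∂volume.restrict (Ici (0 : ℝ)),
      HasDerivWithinAt x (rsIntegral η (fun θ => x (t + θ)) (-t) 0 + forcing L hφ t) (Ici 0) t := by
  filter_upwards [ae_restrict_mem measurableSet_Ici, hη.ae_hasDerivWithinAt_G hφ,
    hη.ae_hasDerivAt_ramp (x 0)] with t ht hG hR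
  rw [(hη.hasRSIntegral_translate h.extension h.extension_apply ht).rsIntegral_eq, add_comm]
  exact ((hG.add ((h.hasDerivAt_extensionPrimitive t).sub hR).hasDerivWithinAt).const_add
    (φ 0)).congr (fun s hs => h.eq_G_add hη hφ hs) (h.eq_G_add hη hφ ht)

end MildSolution

end RFDE

end

theorem theorem2p4 {𝕜 : Type*} [RCLike 𝕜] {n : ℕ} {r : ℝ} (hr : 0 < r)
    (L : C(Set.Icc (-r) (0 : ℝ), Fin n → 𝕜) →L[𝕜] (Fin n → 𝕜))
    (η : ℝ → Matrix (Fin n) (Fin n) 𝕜) (hη : RFDE.Represents hr η L)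
    (φ : ℝ → Fin n → 𝕜) (hφ : IntegrableOn φ (Set.Icc (-r) 0) volume) :
    -- the Riemann–Stieltjes integrals that define `G(t; φ)` exist
    (RFDE.RSIntegrable η (RFDE.integrandG₁ φ) (-r) 0 ∧
      ∀ t, 0 ≤ t → RFDE.RSIntegrable η (RFDE.integrandG₂ φ t) (-r) (-t)) ∧
    ∃ f : ℝ → Fin n → 𝕜,
      LocallyIntegrableOn f (Set.Ici 0) volume ∧
      (∀ t, r ≤ t → f t = 0) ∧
      (∀ᵐ t ∂volume.restrict (Set.Ici (0 : ℝ)),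
        HasDerivWithinAt (RFDE.G r η φ) (f t) (Set.Ici 0) t) ∧
      ∀ x : ℝ → Fin n → 𝕜, RFDE.IsMildSolution L φ x →
        (∀ᵐ t ∂volume.restrict (Set.Ici (0 : ℝ)), DifferentiableWithinAt ℝ x (Set.Ici 0) t) ∧
        (∀ t, 0 ≤ t → RFDE.RSIntegrable η (fun θ => x (t + θ)) (-t) 0) ∧
        ∀ᵐ t ∂volume.restrict (Set.Ici (0 : ℝ)),
          HasDerivWithinAt x
            (RFDE.rsIntegral η (fun θ => x (t + θ)) (-t) 0 + f t) (Set.Ici 0) t := by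
  refine ⟨⟨(hη.hasRSIntegral_integrandG₁ hφ).rsIntegrable,
    fun t ht => (hη.hasRSIntegral_integrandG₂ hφ ht).rsIntegrable⟩, RFDE.forcing L hφ,
    (RFDE.locallyIntegrable_forcing L hφ).locallyIntegrableOn _,
    fun t ht => indicator_of_notMem (notMem_Iio.mpr ht) _, hη.ae_hasDerivWithinAt_G hφ, ?_⟩
  intro x hx
  have hderiv := hx.ae_hasDerivWithinAt hη hφ
  refine ⟨?_, fun t ht =>
    (hη.hasRSIntegral_translate hx.extension hx.extension_apply ht).rsIntegrable, hderiv⟩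
  filter_upwards [hderiv] with t ht using ht.differentiableWithinAt
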